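/- Let $(\mathbb{S},d)$ be a complete separable metric space, $\mathbb{C}\subset\mathbb{S}$ a closed set, $\mathbb{O}=\mathbb{S}\setminus\mathbb{C}$, and let $\mathcal{S}_{\mathbb{O}}$ be the Borel $\sigma$-algebra of $\mathbb{O}$. For $r>0$ put $\mathbb{C}^r=\{x\in\mathbb{S}: d(x,\mathbb{C})<r\}$ (with $d(x,\emptyset)=\infty$); a set $A\subset\mathbb{O}$ is bounded away from $\mathbb{C}$ if $A\subset\mathbb{S}\setminus\mathbb{C}^r$ for some $r>0$. Let $\mathbb{M}_{\mathbb{O}}$ be the set of Borel measures $\mu$ on $\mathbb{O}$ with $\mu(\mathbb{S}\setminus\mathbb{C}^r)<\infty$ for all $r>0$, with the metric $$d_{\mathbb{M}_{\mathbb{O}}}(\mu,\nu)=\int_0^\infty e^{-r}\,\frac{p_r(\mu^{(r)},\nu^{(r)})}{1+p_r(\mu^{(r)},\nu^{(r)})}\,dr ,$$ where $\mu^{(r)}$ is the restriction of $\mu$ to $\mathbb{S}\setminus\mathbb{C}^r$ and $p_r$ is the Prohorov metric on finite Borel measures on $\mathbb{S}\setminus\mathbb{C}^r$. Let $\mathcal{M}_{\mathbb{O}}$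 be the Borel $\sigma$-algebra of $(\mathbb{M}_{\mathbb{O}},d_{\mathbb{M}_{\mathbb{O}}})$, and for $A\in\mathcal{S}_{\mathbb{O}}$ let $\Phi_A:\mathbb{M}_{\mathbb{O}}\to[0,\infty]$, $\Phi_A(\mu)=\mu(A)$. Then: 1. $\mathcal{M}_{\mathbb{O}}$ is also the $\sigma$-algebra generated by the neighbourhoods $\{\nu\in\mathbb{M}_{\mathbb{O}}: |\int f_i\,d\nu-\int f_i\,d\mu|<\varepsilon,\ i=1,\dots,k\}$, where $\mu\in\mathbb{M}_{\mathbb{O}}$, $\varepsilon>0$, $k\geq 0$, and each $f_i$ is a non-negative bounded continuous function on $\mathbb{O}$ that vanishes on $\mathbb{C}^r\cap\mathbb{O}$ for some $r>0$. 2. Let $\mathcal{D}\subset\mathcal{S}_{\mathbb{O}}$ be a $\pi$-system such that the members of $\mathcal{D}$ that are bounded away from $\mathbb{C}$ generate the $\sigma$-algebra $\mathcal{S}_{\mathbb{O}}$ on $\mathbb{O}$ and cover $\mathbb{O}$. Then $\mathcal{M}_{\mathbb{O}}$ is the smallest $\sigma$-algebra on $\mathbb{M}_{\mathbb{O}}$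 with respect to which $\Phi_A$ is measurable for all $A\in\mathcal{D}$. 3. In particular, $\mathcal{M}_{\mathbb{O}}$ is the smallest $\sigma$-algebra on $\mathbb{M}_{\mathbb{O}}$ with respect to which $\Phi_A$ is measurable for all $A\in\mathcal{S}_{\mathbb{O}}$ bounded away from $\mathbb{C}$. -/

import Mathlib

open MeasureTheory Set

namespace MO

/-- The open `r`-neighbourhood `C^r = {x : d(x, C) < r}` of `C` (empty if `C` is empty,
the infimum over the empty set being `∞`). -/
def collar {S : Type*} [MetricSpace S] (C : Set S) (r : ℝ) : Set S :=
  {x | Metric.infEDist x C < ENNReal.ofReal r}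

/-- The complement `S \ C^r`, as a subset of the space `O = S \ C` (for `r > 0`, `S \ C^r ⊆ O`). -/
def away {S : Type*} [MetricSpace S] (C : Set S) (r : ℝ) : Set ↥(Cᶜ) :=
  {x | (x : S) ∉ collar C r}

/-- `A ⊆ O` is bounded away from `C`: `A ⊆ S \ C^r` for some `r > 0`. -/
def BoundedAway {S : Type*} [MetricSpace S] (C : Set S) (A : Set ↥(Cᶜ)) : Prop :=
  ∃ r : ℝ, 0 < r ∧ A ⊆ away C r

/-- The space `M_O` of Borel measures on `O = S \ C` that are finite on `S \ C^r` for every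
`r > 0`. -/
def Space {S : Type*} [MetricSpace S] [MeasurableSpace S] (C : Set S) : Type _ :=
  {μ : Measure ↥(Cᶜ) // ∀ r : ℝ, 0 < r → μ (away C r) < ⊤}

/-- The evaluation map `Φ_A(μ) = μ(A)`. -/
def eval {S : Type*} [MetricSpace S] [MeasurableSpace S] (C : Set S) (A : Set ↥(Cᶜ))
    (μ : Space C) : ENNReal :=
  μ.1 A

/-- The restriction `μ^(r)` of `μ` to `S \ C^r`, as a measure on the metric space `S \ C^r`. -/
noncomputable def restr {S : Type*} [MetricSpace S] [MeasurableSpace S] {C : Set S}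
    (μ : Space C) (r : ℝ) : Measure ↥(away C r) :=
  μ.1.comap Subtype.val

/-- The metric `∫_0^∞ e^{-r} p_r / (1 + p_r) dr` on `M_O`, where `p_r` is the Prohorov distance
of the restrictions to `S \ C^r`. -/
noncomputable def distance {S : Type*} [MetricSpace S] [MeasurableSpace S] {C : Set S}
    (μ ν : Space C) : ℝ :=
  ∫ r in Ioi (0 : ℝ), Real.exp (-r) *
    (levyProkhorovDist (restr μ r) (restr ν r) / (1 + levyProkhorovDist (restr μ r) (restr ν r)))

/-- The topology of the metric `distance`: a set is open if it contains a ball around each of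
its points. -/
def metricTopology {S : Type*} [MetricSpace S] [MeasurableSpace S] (C : Set S) :
    TopologicalSpace (Space C) where
  IsOpen U := ∀ μ ∈ U, ∃ ε : ℝ, 0 < ε ∧ {ν | distance μ ν < ε} ⊆ U
  isOpen_univ := fun _ _ => ⟨1, one_pos, subset_univ _⟩
  isOpen_inter := by
    intro U V hU hV μ hμ
    obtain ⟨a, ha, hUa⟩ := hU μ hμ.1
    obtain ⟨b, hb, hVb⟩ := hV μ hμ.2
    exact ⟨min a b, lt_min ha hb, fun ν hν =>
      ⟨hUa (lt_of_lt_of_le hν (min_le_left a b)), hVb (lt_of_lt_of_le hν (min_le_right a b))⟩⟩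
  isOpen_sUnion := by
    intro T hT μ hμ
    obtain ⟨U, hUT, hμU⟩ := hμ
    obtain ⟨ε, hε, h⟩ := hT U hUT μ hμU
    exact ⟨ε, hε, fun ν hν => ⟨U, hUT, h hν⟩⟩

/-- The Borel σ-algebra of `(M_O, distance)`. -/
def borelAlgebra {S : Type*} [MetricSpace S] [MeasurableSpace S] (C : Set S) :
    MeasurableSpace (Space C) :=
  @borel (Space C) (metricTopology C)

/-- The class `C_O`: non-negative bounded continuous functions on `O` that vanish on `C^r` for
some `r > 0`. -/
def IsTest {S : Type*} [MetricSpace S] (C : Set S) (f : ↥(Cᶜ) → ℝ) : Prop :=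
  Continuous f ∧ (∀ x, 0 ≤ f x) ∧ (∃ M : ℝ, ∀ x, f x ≤ M) ∧
    ∃ r : ℝ, 0 < r ∧ ∀ x : ↥(Cᶜ), (x : S) ∈ collar C r → f x = 0

/-- The σ-algebra on `M_O` generated by the neighbourhoods
`{ν : |∫ f_i dν - ∫ f_i dμ| < ε, i = 1, …, k}` with `μ ∈ M_O`, `ε > 0` and `f_i ∈ C_O`. -/
def neighbourhoodAlgebra {S : Type*} [MetricSpace S] [MeasurableSpace S] (C : Set S) :
    MeasurableSpace (Space C) :=
  MeasurableSpace.generateFrom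
    {U | ∃ (μ : Space C) (ε : ℝ) (k : ℕ) (f : Fin k → ↥(Cᶜ) → ℝ),
      0 < ε ∧ (∀ i, IsTest C (f i)) ∧
        U = {ν : Space C | ∀ i, |(∫ x, f i x ∂ν.1) - ∫ x, f i x ∂μ.1| < ε}}

end MO

/-! Every σ-algebra in the statement is compared with the one generated by all evaluations Φ_A, A
Borel in O. Little data already makes all evaluations measurable. For F closed and bounded away from
C, Φ_F is upper semicontinuous for the metric (`isOpen_setOf_eval_lt`), and it is a pointwise limit
of integrals of thickened indicators. `measurable_eval_of_isPiSystem` passes from these F, or from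
the given π-system, to all Borel sets: a π-λ argument inside each member, where masses are finite,
then a countable subcover (`exists_seq_cover_of_generateFrom`). Conversely (`borelAlgebra_le`),
countably many evaluations control the distance. Cut ever finer countable partitions of O by S \
C^q, q rational. If the masses of these pieces and of the S \ C^q converge, then p_q → 0 for each q.
Since p_r varies with r at most as the masses do, p_r → 0 wherever r ↦ μ(S \ C^r) is continuous,
hence for almost all r, and dominated convergence gives d → 0. So the metric topology is coarser
than one pulled back from a countable power of [0,∞], and a countable base of that power makes
metric-open sets measurable. -/

open Filter Topology Metric
open scoped ENNReal

namespace MO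

/-! ### Geometry of sets bounded away from `C` -/

section Basics

variable {S : Type*} [MetricSpace S] {C : Set S}

lemma mem_away {r : ℝ} {x : ↥(Cᶜ)} :
    x ∈ away C r ↔ ENNReal.ofReal r ≤ infEDist (x : S) C := by
  simp [away, collar]

lemma isClosed_away (C : Set S) (r : ℝ) : IsClosed (away C r) := by
  have : away C r = {x : ↥(Cᶜ) | ENNReal.ofReal r ≤ infEDist (x : S) C} := by
    ext x; exact mem_away
  rw [this]
  exact isClosed_le continuous_const (continuous_infEDist.comp continuous_subtype_val)

lemma away_antitone (C : Set S) : Antitone (away C) := fun _ _ h _ hx =>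
  mem_away.2 ((ENNReal.ofReal_le_ofReal h).trans (mem_away.1 hx))

lemma exists_mem_away (hC : IsClosed C) (x : ↥(Cᶜ)) : ∃ n : ℕ, x ∈ away C (1 / (n + 1 : ℝ)) := by
  have h : 0 < infEDist (x : S) C := by
    rw [pos_iff_ne_zero, Ne, ← mem_closure_iff_infEDist_zero, hC.closure_eq]
    exact x.2
  obtain ⟨n, hn⟩ := ENNReal.exists_inv_nat_lt h.ne'
  refine ⟨n, mem_away.2 (le_trans ?_ hn.le)⟩
  rw [one_div, ENNReal.ofReal_inv_of_pos (by positivity)]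
  refine ENNReal.inv_le_inv.2 ?_
  rw [← ENNReal.ofReal_natCast]
  exact ENNReal.ofReal_le_ofReal (by linarith)

lemma iUnion_away (hC : IsClosed C) : ⋃ n : ℕ, away C (1 / (n + 1 : ℝ)) = univ :=
  eq_univ_of_forall fun x => mem_iUnion.2 (exists_mem_away hC x)

lemma BoundedAway.mono {A B : Set ↥(Cᶜ)} (hB : BoundedAway C B) (h : A ⊆ B) : BoundedAway C A :=
  let ⟨r, hr, hr'⟩ := hB
  ⟨r, hr, h.trans hr'⟩

/-- The distance to `C` is 1-Lipschitz. With `s = δ = R / 2`, small thickenings stay where masses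
are finite. -/
lemma thickening_subset_away {A : Set ↥(Cᶜ)} {R δ s : ℝ} (hA : A ⊆ away C R) (hs : 0 ≤ s)
    (h : s + δ ≤ R) : thickening δ A ⊆ away C s := by
  intro x hx
  obtain ⟨y, hy, hxy⟩ := (mem_thickening_iff_exists_edist_lt _ _).1 hx
  have hδ : 0 < δ := (thickening_nonempty_iff.1 ⟨x, hx⟩).1
  have h1 : ENNReal.ofReal s + ENNReal.ofReal δ ≤ infEDist (x : S) C + ENNReal.ofReal δ :=
    calc ENNReal.ofReal s + ENNReal.ofReal δ = ENNReal.ofReal (s + δ) :=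
          (ENNReal.ofReal_add hs hδ.le).symm
      _ ≤ ENNReal.ofReal R := ENNReal.ofReal_le_ofReal h
      _ ≤ infEDist (y : S) C := mem_away.1 (hA hy)
      _ ≤ infEDist (x : S) C + edist (y : S) x := infEDist_le_infEDist_add_edist
      _ ≤ infEDist (x : S) C + ENNReal.ofReal δ := by
          gcongr
          rw [edist_comm]
          exact hxy.le
  exact mem_away.2 ((ENNReal.add_le_add_iff_right ENNReal.ofReal_ne_top).1 h1)

lemma boundedAway_away {r : ℝ} (hr : 0 < r) : BoundedAway C (away C r) := ⟨r, hr, Subset.rfl⟩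

lemma isPiSystem_closed_boundedAway (C : Set S) :
    IsPiSystem {F : Set ↥(Cᶜ) | IsClosed F ∧ BoundedAway C F} :=
  fun _ hF _ hG _ => ⟨hF.1.inter hG.1, hF.2.mono inter_subset_left⟩

lemma sUnion_closed_boundedAway (hC : IsClosed C) :
    ⋃₀ {F : Set ↥(Cᶜ) | IsClosed F ∧ BoundedAway C F} = univ :=
  eq_univ_of_forall fun x =>
    let ⟨n, hn⟩ := exists_mem_away hC x
    ⟨_, ⟨isClosed_away C _, boundedAway_away (by positivity)⟩, hn⟩

lemma isTest_thickenedIndicator {F : Set ↥(Cᶜ)} {R δ : ℝ} (hF : F ⊆ away C R)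
    (hδ : 0 < δ) (hδR : δ ≤ R / 2) :
    IsTest C fun x => (thickenedIndicator hδ F x : ℝ) := by
  refine ⟨by fun_prop, fun x => NNReal.coe_nonneg _, ⟨1, fun x => ?_⟩, R / 2, by linarith,
    fun x hx => ?_⟩
  · exact_mod_cast thickenedIndicator_le_one hδ F x
  · have : x ∉ thickening δ F := fun h =>
      thickening_subset_away hF (by linarith) (by linarith) h hx
    simp [thickenedIndicator_zero hδ F this]

end Basics

/-! ### Finite masses and bounds on the integrand -/

section Finiteness

variable {S : Type*} [MetricSpace S] [MeasurableSpace S] {C : Set S}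

lemma measure_ne_top_of_boundedAway (μ : Space C) {A : Set ↥(Cᶜ)} (hA : BoundedAway C A) :
    μ.1 A ≠ ⊤ :=
  let ⟨r, hr, h⟩ := hA
  ((measure_mono h).trans_lt (μ.2 r hr)).ne

lemma div_one_add_le_div_one_add {x y : ℝ} (hx : 0 ≤ x) (h : x ≤ y) :
    x / (1 + x) ≤ y / (1 + y) := by
  rw [div_le_div_iff₀ (by linarith) (by linarith)]
  linarith

lemma prokhorov_nonneg {Ω : Type*} [MeasurableSpace Ω] [PseudoEMetricSpace Ω] (μ ν : Measure Ω) :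
    0 ≤ levyProkhorovDist μ ν := ENNReal.toReal_nonneg

lemma distance_integrand_nonneg (μ ν : Space C) (r : ℝ) :
    0 ≤ Real.exp (-r) * (levyProkhorovDist (restr μ r) (restr ν r) /
      (1 + levyProkhorovDist (restr μ r) (restr ν r))) := by
  have := prokhorov_nonneg (restr μ r) (restr ν r)
  positivity

/-- Only positive radii are allowed: for `r ≤ 0` the mass may be infinite, and `real` would then
return 0. -/
lemma antitoneOn_measureReal_away (μ : Space C) :
    AntitoneOn (fun r => μ.1.real (away C r)) (Ioi 0) := fun _ ha _ _ hab =>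
  measureReal_mono (away_antitone C hab) (measure_ne_top_of_boundedAway μ (boundedAway_away ha))

lemma norm_distance_integrand_le (μ ν : Space C) (r : ℝ) :
    ‖Real.exp (-r) * (levyProkhorovDist (restr μ r) (restr ν r) /
      (1 + levyProkhorovDist (restr μ r) (restr ν r)))‖ ≤ Real.exp (-r) := by
  have := prokhorov_nonneg (restr μ r) (restr ν r)
  rw [Real.norm_of_nonneg (distance_integrand_nonneg μ ν r)]
  refine mul_le_of_le_one_right (Real.exp_pos _).le ?_
  rw [div_le_one (by linarith)]
  linarith

lemma measurable_integral_neighbourhoodAlgebra {f : ↥(Cᶜ) → ℝ} (hf : IsTest C f) :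
    Measurable[neighbourhoodAlgebra C] fun ν : Space C => ∫ x, f x ∂ν.1 := by
  let : MeasurableSpace (Space C) := neighbourhoodAlgebra C
  refine measurable_of_Iio fun c => ?_
  have hnn : ∀ ν : Space C, 0 ≤ ∫ x, f x ∂ν.1 := fun ν => integral_nonneg hf.2.1
  rcases le_or_gt c 0 with hc | hc
  · convert! MeasurableSet.empty
    ext ν
    simpa using hc.trans (hnn ν)
  -- Centred at the zero measure, and with `f ≥ 0`, the neighbourhood of radius `c` is exactly `{∫ f
  -- < c}`.
  · refine MeasurableSpace.measurableSet_generateFrom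
      ⟨⟨0, fun _ _ => by simp⟩, c, 1, fun _ => f, hc, fun _ => hf, ?_⟩
    ext ν
    simp [abs_of_nonneg (hnn ν)]

lemma ae_continuousAt_measureReal_away (μ : Space C) :
    ∀ᵐ r ∂volume.restrict (Ioi (0 : ℝ)), ContinuousAt (fun s => μ.1.real (away C s)) r := by
  have hc := (antitoneOn_measureReal_away μ).countable_not_continuousWithinAt
  rw [ae_restrict_iff' measurableSet_Ioi]
  filter_upwards [compl_mem_ae_iff.2 (hc.measure_zero volume)] with r hr hr0
  by_contra hcon
  exact hr ⟨hr0, fun h => hcon (h.continuousAt (Ioi_mem_nhds hr0))⟩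

end Finiteness

/-! ### Restrictions, their Prohorov distances, and semicontinuity of evaluations -/

section Restriction

variable {S : Type*} [MetricSpace S] [MeasurableSpace S] [BorelSpace S] {C : Set S}

lemma measurableSet_away (C : Set S) (r : ℝ) : MeasurableSet (away C r) :=
  (isClosed_away C r).measurableSet

lemma restr_apply (μ : Space C) (r : ℝ) (B : Set (away C r)) :
    restr μ r B = μ.1 (Subtype.val '' B) :=
  (MeasurableEmbedding.subtype_coe (measurableSet_away C r)).comap_apply _ _

lemma isFiniteMeasure_restr (μ : Space C) {r : ℝ} (hr : 0 < r) : IsFiniteMeasure (restr μ r) :=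
  ⟨by rw [restr_apply]; simpa using μ.2 r hr⟩

lemma image_val_thickening {X : Type*} [PseudoEMetricSpace X] {s : Set X} (δ : ℝ) (B : Set s) :
    Subtype.val '' thickening δ B = thickening δ (Subtype.val '' B) ∩ s := by
  ext x
  simp only [mem_image, mem_inter_iff, mem_thickening_iff_exists_edist_lt]
  constructor
  · rintro ⟨y, ⟨z, hz, h⟩, rfl⟩
    exact ⟨⟨z, ⟨z, hz, rfl⟩, h⟩, y.2⟩
  · rintro ⟨⟨_, ⟨z, hz, rfl⟩, h⟩, hx⟩
    exact ⟨⟨x, hx⟩, ⟨z, hz, h⟩, rfl⟩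

lemma prokhorov_le_of_forall {μ ν : Space C} {r : ℝ} {ε : ℝ≥0∞}
    (h : ∀ B ⊆ away C r, MeasurableSet B →
      μ.1 B ≤ ν.1 (thickening ε.toReal B ∩ away C r) + ε ∧
      ν.1 B ≤ μ.1 (thickening ε.toReal B ∩ away C r) + ε) :
    levyProkhorovEDist (restr μ r) (restr ν r) ≤ ε := by
  refine sInf_le fun B hB => ?_
  simp only [restr_apply, image_val_thickening]
  exact h _ (by rintro _ ⟨x, -, rfl⟩; exact x.2) ((measurableSet_away C r).subtype_image hB)

lemma measure_le_of_prokhorov_lt {μ ν : Space C} {r : ℝ} {ε : ℝ≥0∞}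
    (h : levyProkhorovEDist (restr μ r) (restr ν r) < ε) {B : Set ↥(Cᶜ)} (hB : B ⊆ away C r)
    (hBm : MeasurableSet B) :
    μ.1 B ≤ ν.1 (thickening ε.toReal B ∩ away C r) + ε := by
  have := left_measure_le_of_levyProkhorovEDist_lt h
    (B := (Subtype.val ⁻¹' B : Set (away C r))) (measurable_subtype_coe hBm)
  rw [restr_apply, restr_apply, image_val_thickening, Subtype.image_preimage_coe,
    inter_eq_self_of_subset_right hB] at this
  exact this

/-- The mass of `μ` on the shell `{a ≤ d(x, C) < b}`. -/
lemma measureReal_away_sub (μ : Space C) {a b : ℝ} (ha : 0 < a) (hab : a ≤ b) :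
    μ.1.real (away C a \ away C b) = μ.1.real (away C a) - μ.1.real (away C b) :=
  measureReal_sdiff (away_antitone C hab)
    (measurableSet_away C b)
    (measure_ne_top_of_boundedAway μ (boundedAway_away ha))

/-- The part of a test set `B` lying in the shell is discarded, at the cost of the shell's mass. -/
lemma prokhorovEDist_le_add_shell (μ ν : Space C) {a b : ℝ} (ha : 0 < a) (hab : a ≤ b) :
    levyProkhorovEDist (restr μ a) (restr ν a) ≤ levyProkhorovEDist (restr μ b) (restr ν b) +
      (μ.1 (away C a \ away C b) + ν.1 (away C a \ away C b)) := by
  have key : ∀ (μ ν : Space C) (ε : ℝ≥0∞), ε ≠ ⊤ →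
      levyProkhorovEDist (restr μ b) (restr ν b) < ε → ∀ B ⊆ away C a, MeasurableSet B →
      ∀ δ : ℝ≥0∞, δ ≠ ⊤ → μ.1 (away C a \ away C b) ≤ δ →
        μ.1 B ≤ ν.1 (thickening (ε + δ).toReal B ∩ away C a) + (ε + δ) := by
    intro μ ν ε hε h B hB hBm δ hδ hμδ
    calc μ.1 B ≤ μ.1 (B ∩ away C b) + μ.1 (away C a \ away C b) := by
          refine (measure_mono ?_).trans (measure_union_le _ _)
          intro x hx
          by_cases hxb : x ∈ away C b
          · exact Or.inl ⟨hx, hxb⟩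
          · exact Or.inr ⟨hB hx, hxb⟩
      _ ≤ ν.1 (thickening ε.toReal (B ∩ away C b) ∩ away C b) + ε + δ :=
          add_le_add (measure_le_of_prokhorov_lt h inter_subset_right
            (hBm.inter (measurableSet_away C b))) hμδ
      _ ≤ ν.1 (thickening (ε + δ).toReal B ∩ away C a) + ε + δ := by
          gcongr
          · exact (thickening_subset_of_subset _ inter_subset_left).trans (thickening_mono
              (ENNReal.toReal_mono (ENNReal.add_ne_top.2 ⟨hε, hδ⟩) le_self_add) _)
          · exact away_antitone C hab
      _ = _ := add_assoc _ _ _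
  have := isFiniteMeasure_restr μ (ha.trans_le hab)
  have := isFiniteMeasure_restr ν (ha.trans_le hab)
  have hfin : ∀ κ : Space C, κ.1 (away C a \ away C b) ≠ ⊤ := fun κ =>
    measure_ne_top_of_boundedAway κ ((boundedAway_away ha).mono sdiff_subset)
  have hδ : μ.1 (away C a \ away C b) + ν.1 (away C a \ away C b) ≠ ⊤ :=
    ENNReal.add_ne_top.2 ⟨hfin μ, hfin ν⟩
  rw [← tsub_le_iff_right]
  refine le_of_forall_gt_imp_ge_of_dense fun ε hε => ?_
  rw [tsub_le_iff_right]
  rcases eq_or_ne ε ⊤ with rfl | hε'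
  · simp
  refine prokhorov_le_of_forall fun B hB hBm => ⟨?_, ?_⟩
  · exact key μ ν ε hε' hε B hB hBm _ hδ le_self_add
  · rw [levyProkhorovEDist_comm] at hε
    exact key ν μ ε hε' hε B hB hBm _ hδ le_add_self

/-- Here `B` avoids the shell but its thickening may enter it, so the shell is charged to the other
measure. -/
lemma prokhorovEDist_le_add_shell' (μ ν : Space C) {a b : ℝ} (ha : 0 < a) (hab : a ≤ b) :
    levyProkhorovEDist (restr μ b) (restr ν b) ≤ levyProkhorovEDist (restr μ a) (restr ν a) +
      (μ.1 (away C a \ away C b) + ν.1 (away C a \ away C b)) := by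
  have key : ∀ (μ ν : Space C) (ε : ℝ≥0∞), ε ≠ ⊤ →
      levyProkhorovEDist (restr μ a) (restr ν a) < ε → ∀ B ⊆ away C b, MeasurableSet B →
      ∀ δ : ℝ≥0∞, δ ≠ ⊤ → ν.1 (away C a \ away C b) ≤ δ →
        μ.1 B ≤ ν.1 (thickening (ε + δ).toReal B ∩ away C b) + (ε + δ) := by
    intro μ ν ε hε h B hB hBm δ hδ hνδ
    calc μ.1 B ≤ ν.1 (thickening ε.toReal B ∩ away C a) + ε :=
          measure_le_of_prokhorov_lt h (hB.trans (away_antitone C hab)) hBm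
      _ ≤ ν.1 (thickening (ε + δ).toReal B ∩ away C b) + δ + ε := by
          gcongr
          refine (measure_mono ?_).trans ((measure_union_le _ _).trans (add_le_add_right hνδ _))
          rintro x ⟨hx, hxa⟩
          by_cases hxb : x ∈ away C b
          · refine Or.inl ⟨thickening_mono ?_ _ hx, hxb⟩
            exact ENNReal.toReal_mono (ENNReal.add_ne_top.2 ⟨hε, hδ⟩) le_self_add
          · exact Or.inr ⟨hxa, hxb⟩
      _ = _ := by rw [add_assoc, add_comm δ]
  have := isFiniteMeasure_restr μ ha
  have := isFiniteMeasure_restr ν ha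
  have hfin : ∀ κ : Space C, κ.1 (away C a \ away C b) ≠ ⊤ := fun κ =>
    measure_ne_top_of_boundedAway κ ((boundedAway_away ha).mono sdiff_subset)
  have hδ : μ.1 (away C a \ away C b) + ν.1 (away C a \ away C b) ≠ ⊤ :=
    ENNReal.add_ne_top.2 ⟨hfin μ, hfin ν⟩
  rw [← tsub_le_iff_right]
  refine le_of_forall_gt_imp_ge_of_dense fun ε hε => ?_
  rw [tsub_le_iff_right]
  rcases eq_or_ne ε ⊤ with rfl | hε'
  · simp
  refine prokhorov_le_of_forall fun B hB hBm => ⟨?_, ?_⟩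
  · exact key μ ν ε hε' hε B hB hBm _ hδ le_add_self
  · rw [levyProkhorovEDist_comm] at hε
    exact key ν μ ε hε' hε B hB hBm _ hδ le_self_add

/-- The Prohorov distance `p_r` of the restrictions varies with `r` at most as the masses do. -/
lemma abs_prokhorov_sub_le (μ ν : Space C) {a b : ℝ} (ha : 0 < a) (hab : a ≤ b) :
    |levyProkhorovDist (restr μ a) (restr ν a) - levyProkhorovDist (restr μ b) (restr ν b)| ≤
      (μ.1.real (away C a) - μ.1.real (away C b)) +
        (ν.1.real (away C a) - ν.1.real (away C b)) := by
  have := isFiniteMeasure_restr μ ha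
  have := isFiniteMeasure_restr ν ha
  have := isFiniteMeasure_restr μ (ha.trans_le hab)
  have := isFiniteMeasure_restr ν (ha.trans_le hab)
  have hfin : ∀ κ : Space C, κ.1 (away C a \ away C b) ≠ ⊤ := fun κ =>
    measure_ne_top_of_boundedAway κ ((boundedAway_away ha).mono sdiff_subset)
  have hδ : μ.1 (away C a \ away C b) + ν.1 (away C a \ away C b) ≠ ⊤ :=
    ENNReal.add_ne_top.2 ⟨hfin μ, hfin ν⟩
  have h1 := ENNReal.toReal_mono (by simp [hfin]) (prokhorovEDist_le_add_shell μ ν ha hab)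
  have h2 := ENNReal.toReal_mono (by simp [hfin]) (prokhorovEDist_le_add_shell' μ ν ha hab)
  rw [ENNReal.toReal_add (by simp) hδ, ENNReal.toReal_add (hfin μ) (hfin ν)] at h1 h2
  rw [← measureReal_away_sub μ ha hab, ← measureReal_away_sub ν ha hab, abs_sub_le_iff]
  simp only [levyProkhorovDist, Measure.real]
  constructor <;> linarith

lemma aemeasurable_prokhorov (μ ν : Space C) :
    AEMeasurable (fun r => levyProkhorovDist (restr μ r) (restr ν r))
      (volume.restrict (Ioi (0 : ℝ))) := by
  let G : ℝ → ℝ := fun r => μ.1.real (away C r) + ν.1.real (away C r)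
  have hG : AntitoneOn G (Ioi 0) :=
    (antitoneOn_measureReal_away μ).add (antitoneOn_measureReal_away ν)
  -- The oscillation bound makes `p_r` a difference of two antitone functions of `r`, hence a.e.
  -- measurable.
  have hH : AntitoneOn (fun r => G r - levyProkhorovDist (restr μ r) (restr ν r)) (Ioi 0) := by
    intro a ha b _ hab
    have := (le_abs_self _).trans (abs_prokhorov_sub_le μ ν ha hab)
    simp only [G]
    linarith
  have := (aemeasurable_restrict_of_antitoneOn (μ := volume) measurableSet_Ioi hG).sub
    (aemeasurable_restrict_of_antitoneOn (μ := volume) measurableSet_Ioi hH)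
  refine this.congr (ae_of_all _ fun r => ?_)
  simp

lemma aestronglyMeasurable_distance_integrand (μ ν : Space C) :
    AEStronglyMeasurable (fun r => Real.exp (-r) * (levyProkhorovDist (restr μ r) (restr ν r) /
      (1 + levyProkhorovDist (restr μ r) (restr ν r)))) (volume.restrict (Ioi (0 : ℝ))) := by
  have := aemeasurable_prokhorov μ ν
  have h : Measurable fun r : ℝ => Real.exp (-r) := by fun_prop
  exact (h.aemeasurable.mul (this.div (this.const_add 1))).aestronglyMeasurable

lemma integrableOn_exp_neg : IntegrableOn (fun r : ℝ => Real.exp (-r)) (Ioi 0) :=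
  integrableOn_exp_neg_Ioi 0

/-- Without integrability `distance` would default to 0, and its smallness would carry no
information. -/
lemma integrableOn_distance_integrand (μ ν : Space C) :
    IntegrableOn (fun r => Real.exp (-r) * (levyProkhorovDist (restr μ r) (restr ν r) /
      (1 + levyProkhorovDist (restr μ r) (restr ν r)))) (Ioi (0 : ℝ)) :=
  integrableOn_exp_neg.mono' (aestronglyMeasurable_distance_integrand μ ν)
    (ae_of_all _ (norm_distance_integrand_le μ ν))

/-- Measures at small distance have restrictions at small Prohorov distance, for some `r < R`. -/
lemma exists_prokhorov_lt_of_distance_lt (C : Set S) {R δ : ℝ} (hR : 0 < R) (hδ : 0 < δ) :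
    ∃ ε : ℝ, 0 < ε ∧ ∀ μ ν : Space C, distance μ ν < ε →
      ∃ r ∈ Ioo 0 R, levyProkhorovDist (restr μ r) (restr ν r) < δ := by
  -- If `p_r ≥ δ` on all of `(0, R)`, the integrand is at least `exp (-R) * (δ / (1 + δ))` there.
  refine ⟨R * (Real.exp (-R) * (δ / (1 + δ))), by positivity, fun μ ν h => ?_⟩
  by_contra! hcon
  refine h.not_ge ?_
  have h1 : ∫ _ in Ioo 0 R, Real.exp (-R) * (δ / (1 + δ)) = R * (Real.exp (-R) * (δ / (1 + δ))) := by
    simp [hR.le]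
  rw [← h1]
  have hi := integrableOn_distance_integrand μ ν
  calc _ ≤ ∫ r in Ioo 0 R, Real.exp (-r) * (levyProkhorovDist (restr μ r) (restr ν r) /
      (1 + levyProkhorovDist (restr μ r) (restr ν r))) := by
        refine setIntegral_mono_on (integrableOn_const (by simp)) (hi.mono_set Ioo_subset_Ioi_self)
          measurableSet_Ioo fun r hr => ?_
        have := div_one_add_le_div_one_add hδ.le (hcon r hr)
        have := Real.exp_le_exp.2 (neg_le_neg hr.2.le)
        exact mul_le_mul this ‹_› (by positivity) (Real.exp_pos _).le
    _ ≤ _ := setIntegral_mono_set hi (ae_of_all _ (distance_integrand_nonneg μ ν))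
        Ioo_subset_Ioi_self.eventuallyLE

/-- Evaluation at a closed set bounded away from `C` is upper semicontinuous. -/
lemma isOpen_setOf_eval_lt {F : Set ↥(Cᶜ)} (hF : IsClosed F) (hFb : BoundedAway C F) (c : ℝ≥0∞) :
    IsOpen[metricTopology C] {ν : Space C | eval C F ν < c} := by
  intro μ hμ
  obtain ⟨R, hR, hFR⟩ := hFb
  -- the mass of a thickening of `F`, cut off at `R / 2`
  let κ : Measure ↥(Cᶜ) := μ.1.restrict (away C (R / 2))
  have : IsFiniteMeasure κ := ⟨by simpa [κ] using μ.2 (R / 2) (by linarith)⟩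
  have hκ : κ F = μ.1 F := by
    rw [Measure.restrict_apply hF.measurableSet, inter_eq_self_of_subset_left]
    exact hFR.trans (away_antitone C (by linarith))
  have hlim : Tendsto (fun δ : ℝ => κ (thickening δ F) + ENNReal.ofReal δ) (𝓝[>] 0)
      (𝓝 (κ F + 0)) := by
    refine (tendsto_measure_thickening_of_isClosed ⟨1, one_pos, measure_ne_top _ _⟩ hF).add ?_
    have : Tendsto ENNReal.ofReal (𝓝 0) (𝓝 (ENNReal.ofReal 0)) :=
      ENNReal.continuous_ofReal.tendsto 0
    rw [ENNReal.ofReal_zero] at this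
    exact this.mono_left nhdsWithin_le_nhds
  rw [add_zero, hκ] at hlim
  have hmem : Ioc (0 : ℝ) (R / 2) ∈ 𝓝[>] (0 : ℝ) := Ioc_mem_nhdsGT (by linarith)
  obtain ⟨δ, hδc, hδ0, hδR⟩ := ((hlim.eventually_lt_const hμ).and hmem).exists
  -- Some `r < R` has `p_r < δ`. Then `F` lies in `away C r`, and ν(F) is at most the κ-mass of the
  -- `δ`-thickening plus `δ`, which is below `c`.
  obtain ⟨ε, hε, hεδ⟩ := exists_prokhorov_lt_of_distance_lt C hR hδ0
  refine ⟨ε, hε, fun ν hν => ?_⟩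
  obtain ⟨r, ⟨hr0, hrR⟩, hr⟩ := hεδ μ ν hν
  have := isFiniteMeasure_restr μ hr0
  have := isFiniteMeasure_restr ν hr0
  have hr' : levyProkhorovEDist (restr ν r) (restr μ r) < ENNReal.ofReal δ := by
    rw [levyProkhorovEDist_comm]
    exact (ENNReal.lt_ofReal_iff_toReal_lt (by simp)).2 hr
  have h1 := measure_le_of_prokhorov_lt hr' (hFR.trans (away_antitone C hrR.le)) hF.measurableSet
  rw [ENNReal.toReal_ofReal hδ0.le] at h1
  refine lt_of_le_of_lt (h1.trans ?_) hδc
  refine add_le_add_left ?_ _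
  simp only [κ]
  rw [Measure.restrict_apply isOpen_thickening.measurableSet]
  refine measure_mono fun x hx => ⟨hx.1, ?_⟩
  exact thickening_subset_away hFR (by linarith) (by linarith) hx.1

lemma generateFrom_closed_boundedAway (hC : IsClosed C) :
    MeasurableSpace.generateFrom {F : Set ↥(Cᶜ) | IsClosed F ∧ BoundedAway C F} =
      (inferInstance : MeasurableSpace ↥(Cᶜ)) := by
  refine le_antisymm (MeasurableSpace.generateFrom_le fun F hF => hF.1.measurableSet) ?_
  have hb : (inferInstance : MeasurableSpace ↥(Cᶜ)) = borel _ := BorelSpace.measurable_eq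
  rw [hb, borel_eq_generateFrom_isClosed]
  refine MeasurableSpace.generateFrom_le fun F hF => ?_
  rw [← inter_univ F, ← iUnion_away hC, inter_iUnion]
  refine MeasurableSet.iUnion fun n => MeasurableSpace.measurableSet_generateFrom
    ⟨IsClosed.inter hF (isClosed_away C _), (boundedAway_away ?_).mono inter_subset_right⟩
  positivity

/-- The integrals of test functions are measurable if the evaluations are. -/
lemma measurable_integral_of_measurable_eval {m : MeasurableSpace (Space C)}
    (hm : ∀ A : Set ↥(Cᶜ), MeasurableSet A → Measurable (eval C A)) {f : ↥(Cᶜ) → ℝ}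
    (hf : IsTest C f) : Measurable fun ν : Space C => ∫ x, f x ∂ν.1 := by
  have h : Measurable fun ν : Space C => ν.1 := Measure.measurable_of_measurable_coe _ hm
  have heq : (fun ν : Space C => ∫ x, f x ∂ν.1) =
      fun ν => (∫⁻ x, ENNReal.ofReal (f x) ∂ν.1).toReal := by
    ext ν
    exact integral_eq_lintegral_of_nonneg_ae (ae_of_all _ hf.2.1)
      hf.1.measurable.aestronglyMeasurable
  rw [heq]
  exact ((Measure.measurable_lintegral hf.1.measurable.ennreal_ofReal).comp h).ennreal_toReal

lemma neighbourhoodAlgebra_le {m : MeasurableSpace (Space C)}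
    (hm : ∀ A : Set ↥(Cᶜ), MeasurableSet A → Measurable (eval C A)) :
    neighbourhoodAlgebra C ≤ m := by
  refine MeasurableSpace.generateFrom_le ?_
  rintro _ ⟨μ, ε, k, f, -, hf, rfl⟩
  rw [ofPred_forall]
  refine MeasurableSet.iInter fun i => ?_
  have h := measurable_integral_of_measurable_eval hm (hf i)
  exact measurableSet_lt ((h.sub_const _).abs) measurable_const

end Restriction

/-! ### From a π-system to all evaluations -/

section PiSystem

/-- In a countably separated space, a cover which generates the σ-algebra has a countable
subcover. -/
lemma exists_seq_cover_of_generateFrom {X : Type*} [m : MeasurableSpace X]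
    [MeasurableSpace.CountablySeparated X] {D : Set (Set X)}
    (hgen : MeasurableSpace.generateFrom D = m) (hcov : ⋃₀ D = univ) (hne : D.Nonempty) :
    ∃ B : ℕ → Set X, (∀ n, B n ∈ D) ∧ ⋃ n, B n = univ := by
  -- Sets which are countably covered, or whose complement is, form a σ-algebra containing `D`.
  have hdich : ∀ E : Set X, MeasurableSet E →
      ∃ T ⊆ D, T.Countable ∧ (E ⊆ ⋃₀ T ∨ Eᶜ ⊆ ⋃₀ T) := by
    intro E hE
    rw [← hgen] at hE
    induction E, hE using MeasurableSpace.generateFrom_induction with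
    | hC t ht _ => exact ⟨{t}, by simpa using ht, countable_singleton t, Or.inl (by simp)⟩
    | empty => exact ⟨∅, empty_subset _, countable_empty, Or.inl (empty_subset _)⟩
    | compl t _ ih =>
      obtain ⟨T, hT, hc, h⟩ := ih
      exact ⟨T, hT, hc, by rwa [compl_compl, or_comm]⟩
    | iUnion s _ ih =>
      choose T hT hc h using ih
      refine ⟨⋃ n, T n, iUnion_subset hT, countable_iUnion hc, ?_⟩
      have hsub : ∀ n, ⋃₀ T n ⊆ ⋃₀ ⋃ n, T n := fun n => sUnion_mono (subset_iUnion T n)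
      by_cases hall : ∀ n, s n ⊆ ⋃₀ T n
      · exact Or.inl (iUnion_subset fun n => (hall n).trans (hsub n))
      · push Not at hall
        obtain ⟨n, hn⟩ := hall
        refine Or.inr (Subset.trans ?_ (((h n).resolve_left hn).trans (hsub n)))
        exact compl_subset_compl.2 (subset_iUnion s n)
  obtain ⟨U, hU, hsep⟩ := exists_seq_separating X (p := MeasurableSet) (s₀ := ∅) .empty univ
  choose T hT hc hdich' using fun n => hdich (U n) (hU n)
  -- No member of the separating sequence splits the uncovered part, so at most one point is left
  -- and one further member of `D` covers it.
  have hsub : (⋃₀ ⋃ n, T n)ᶜ.Subsingleton := by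
    intro x hx y hy
    refine hsep x trivial y trivial fun n => ?_
    have hx' : x ∉ ⋃₀ T n := fun h => hx (sUnion_mono (subset_iUnion T n) h)
    have hy' : y ∉ ⋃₀ T n := fun h => hy (sUnion_mono (subset_iUnion T n) h)
    rcases hdich' n with h | h
    · exact ⟨fun hxU => absurd (h hxU) hx', fun hyU => absurd (h hyU) hy'⟩
    · exact ⟨fun _ => by_contra fun hyU => hy' (h hyU), fun _ => by_contra fun hxU => hx' (h hxU)⟩
  obtain ⟨A, hAD, hA⟩ : ∃ A ∈ D, (⋃₀ ⋃ n, T n)ᶜ ⊆ A := by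
    rcases (⋃₀ ⋃ n, T n)ᶜ.eq_empty_or_nonempty with h | ⟨x, hx⟩
    · exact ⟨hne.some, hne.some_mem, by simp [h]⟩
    · obtain ⟨A, hAD, hxA⟩ := (hcov ▸ mem_univ x : x ∈ ⋃₀ D)
      exact ⟨A, hAD, fun y hy => hsub hx hy ▸ hxA⟩
  obtain ⟨B, hB⟩ := ((countable_iUnion hc).insert A).exists_eq_range (insert_nonempty _ _)
  refine ⟨B, fun n => ?_, eq_univ_of_forall fun x => ?_⟩
  · have : B n ∈ insert A (⋃ n, T n) := hB ▸ mem_range_self n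
    rcases this with h | h
    · exact h ▸ hAD
    · exact iUnion_subset hT h
  · rw [← sUnion_range, ← hB, sUnion_insert]
    by_cases hx : x ∈ ⋃₀ ⋃ n, T n
    · exact Or.inr hx
    · exact Or.inl (hA hx)

variable {S : Type*} [MetricSpace S] [TopologicalSpace.SeparableSpace S] [MeasurableSpace S]
  [BorelSpace S] {C : Set S}

/-- If the evaluations on a generating and covering π-system of sets bounded away from `C` are
measurable, then all evaluations are. -/
lemma measurable_eval_of_isPiSystem {m : MeasurableSpace (Space C)} {D : Set (Set ↥(Cᶜ))}
    (hpi : IsPiSystem D) (hb : ∀ A ∈ D, BoundedAway C A)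
    (hgen : MeasurableSpace.generateFrom D = (inferInstance : MeasurableSpace ↥(Cᶜ)))
    (hcov : ⋃₀ D = univ) (hm : ∀ A ∈ D, Measurable (eval C A)) {A : Set ↥(Cᶜ)}
    (hA : MeasurableSet A) : Measurable (eval C A) := by
  have : SecondCountableTopology S := UniformSpace.secondCountable_of_separable S
  rcases D.eq_empty_or_nonempty with rfl | hne
  · have hA0 : A = ∅ := by
      rw [sUnion_empty] at hcov
      exact eq_empty_of_subset_empty (hcov ▸ subset_univ A)
    have : eval C A = fun _ => 0 := by
      ext μ
      simp [eval, hA0]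
    rw [this]
    exact measurable_const
  have hDm : ∀ B ∈ D, MeasurableSet B := fun B hB => by
    have := MeasurableSpace.measurableSet_generateFrom hB
    rwa [hgen] at this
  have hinter : ∀ B ∈ D, ∀ E : Set ↥(Cᶜ), MeasurableSet E →
      Measurable fun μ : Space C => μ.1 (E ∩ B) := by
    intro B hB
    -- The π-λ argument needs finite measures, hence the restriction to a single member `B`.
    have hfin : ∀ μ : Space C, IsFiniteMeasure (μ.1.restrict B) := fun μ =>
      ⟨by simpa using (measure_ne_top_of_boundedAway μ (hb B hB)).lt_top⟩
    have h : Measurable fun μ : Space C => μ.1.restrict B := by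
      refine Measurable.measure_of_isPiSystem hgen.symm hpi (fun E hE => ?_) ?_
      · simp only [Measure.restrict_apply (hDm E hE)]
        rcases (E ∩ B).eq_empty_or_nonempty with h | h
        · simp [h]
        · exact hm _ (hpi E hE B hB h)
      · simpa only [Measure.restrict_apply_univ] using! hm B hB
    intro E hE
    simpa only [Measure.restrict_apply hE] using Measure.measurable_measure.1 h E hE
  obtain ⟨B, hBD, hB⟩ := exists_seq_cover_of_generateFrom hgen hcov hne
  have hBm := fun n => hDm _ (hBD n)
  have hsum : eval C A = fun μ => ∑' n, μ.1 (A ∩ disjointed B n ∩ B n) := by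
    ext μ
    have h1 : ∀ n, A ∩ disjointed B n ∩ B n = A ∩ disjointed B n := fun n =>
      inter_eq_self_of_subset_left (inter_subset_right.trans (disjointed_subset B n))
    simp only [h1]
    rw [← measure_iUnion, ← inter_iUnion, iUnion_disjointed, hB, inter_univ]
    · rfl
    · exact fun i j hij => ((disjoint_disjointed B) hij).mono inter_subset_right inter_subset_right
    · exact fun n => hA.inter (MeasurableSet.disjointed hBm n)
  rw [hsum]
  exact Measurable.tsum fun n =>
    hinter (B n) (hBD n) _ (hA.inter (MeasurableSet.disjointed hBm n))

lemma measurable_eval_of_isClosed (hC : IsClosed C) {m : MeasurableSpace (Space C)}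
    (hm : ∀ F : Set ↥(Cᶜ), IsClosed F → BoundedAway C F → Measurable (eval C F))
    {A : Set ↥(Cᶜ)} (hA : MeasurableSet A) : Measurable (eval C A) :=
  measurable_eval_of_isPiSystem (isPiSystem_closed_boundedAway C) (fun _ h => h.2)
    (generateFrom_closed_boundedAway hC) (sUnion_closed_boundedAway hC)
    (fun F hF => hm F hF.1 hF.2) hA

/-- All evaluations are Borel measurable. -/
lemma measurable_eval_borelAlgebra (hC : IsClosed C) {A : Set ↥(Cᶜ)} (hA : MeasurableSet A) :
    Measurable[borelAlgebra C] (eval C A) := by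
  let : TopologicalSpace (Space C) := metricTopology C
  let : MeasurableSpace (Space C) := borelAlgebra C
  have : BorelSpace (Space C) := ⟨rfl⟩
  exact measurable_eval_of_isClosed hC (fun F hF hFb =>
    measurable_of_Iio fun c => (isOpen_setOf_eval_lt hF hFb c).measurableSet) hA

/-- All evaluations are measurable for the σ-algebra generated by the neighbourhoods. -/
lemma measurable_eval_neighbourhoodAlgebra (hC : IsClosed C) {A : Set ↥(Cᶜ)}
    (hA : MeasurableSet A) : Measurable[neighbourhoodAlgebra C] (eval C A) := by
  let : MeasurableSpace (Space C) := neighbourhoodAlgebra C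
  refine measurable_eval_of_isClosed hC (fun F hF hFb => ?_) hA
  obtain ⟨R, hR, hFR⟩ := id hFb
  let δ : ℕ → ℝ := fun n => R / 2 * (1 / (n + 1 : ℝ))
  have hδ : ∀ n, 0 < δ n := fun n => by positivity
  have hδR : ∀ n, δ n ≤ R / 2 := fun n => by
    refine mul_le_of_le_one_right (by linarith) ?_
    rw [div_le_one (by positivity)]
    linarith [n.cast_nonneg (α := ℝ)]
  have hlim : Tendsto δ atTop (𝓝 0) := by
    simpa only [mul_zero] using
      (tendsto_one_div_add_atTop_nhds_zero_nat (𝕜 := ℝ)).const_mul (R / 2)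
  have htest := fun n => isTest_thickenedIndicator hFR (hδ n) (hδR n)
  have hreal : Measurable fun ν : Space C => ν.1.real F := by
    refine measurable_of_tendsto_metrizable
      (fun n => measurable_integral_neighbourhoodAlgebra (htest n)) (tendsto_pi_nhds.2 fun ν => ?_)
    -- The limit theorem needs a finite measure. The cut-off changes no integral, as each thickened
    -- indicator vanishes off `away C (R / 2)`.
    let κ : Measure ↥(Cᶜ) := ν.1.restrict (away C (R / 2))
    have : IsFiniteMeasure κ := ⟨by simpa [κ] using ν.2 (R / 2) (by linarith)⟩
    have h := tendsto_integral_thickenedIndicator_of_isClosed κ hF hδ hlim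
    have hκ : κ.real F = ν.1.real F := by
      simp only [κ, Measure.real]
      rw [Measure.restrict_apply hF.measurableSet, inter_eq_self_of_subset_left]
      exact hFR.trans (away_antitone C (by linarith))
    rw [hκ] at h
    refine h.congr fun n => ?_
    refine setIntegral_eq_integral_of_forall_compl_eq_zero fun x hx => ?_
    have : x ∉ thickening (δ n) F := fun h =>
      hx (thickening_subset_away hFR (by linarith) (by linarith [hδR n]) h)
    simp [thickenedIndicator_zero (hδ n) F this]
  have heq : eval C F = fun ν => ENNReal.ofReal (ν.1.real F) := by
    ext ν
    exact (ENNReal.ofReal_toReal (measure_ne_top_of_boundedAway ν hFb)).symm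
  rw [heq]
  exact hreal.ennreal_ofReal

end PiSystem

/-! ### Prohorov convergence from masses of partition cells -/

section ProkhorovConvergence

/-- Replace `B` by the cells meeting it: being small, they lie in its thickening. Each of the first
`N` cells costs at most `δ`, and the others are charged as a whole. -/
lemma measure_le_thickening_add_of_partition {Ω : Type*} [MeasurableSpace Ω]
    [PseudoEMetricSpace Ω] {μ ν : Measure Ω} {A : ℕ → Set Ω} {N : ℕ} {ε : ℝ} {δ : ℝ≥0∞}
    (hA : ∀ i, MeasurableSet (A i)) (hdisj : Pairwise (Function.onFun Disjoint A))
    (hsmall : ∀ i, ∀ x ∈ A i, ∀ y ∈ A i, edist x y < ENNReal.ofReal ε)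
    (hle : ∀ i < N, μ (A i) ≤ ν (A i) + δ) (B : Set Ω) :
    μ B ≤ ν (thickening ε B) + (N * δ + μ (⋃ i ∈ Finset.range N, A i)ᶜ) := by
  classical
  let I := (Finset.range N).filter fun i => (A i ∩ B).Nonempty
  have hsub : B ⊆ (⋃ i ∈ I, A i) ∪ (⋃ i ∈ Finset.range N, A i)ᶜ := by
    intro x hx
    by_cases h : x ∈ ⋃ i ∈ Finset.range N, A i
    · obtain ⟨i, hi, hxi⟩ := mem_iUnion₂.1 h
      exact Or.inl (mem_iUnion₂.2 ⟨i, Finset.mem_filter.2 ⟨hi, x, hxi, hx⟩, hxi⟩)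
    · exact Or.inr h
  have hthick : ⋃ i ∈ I, A i ⊆ thickening ε B := by
    refine iUnion₂_subset fun i hi x hx => ?_
    obtain ⟨y, hyA, hyB⟩ := (Finset.mem_filter.1 hi).2
    exact (mem_thickening_iff_exists_edist_lt _ _).2 ⟨y, hyB, hsmall i x hx y hyA⟩
  calc μ B ≤ μ (⋃ i ∈ I, A i) + μ (⋃ i ∈ Finset.range N, A i)ᶜ :=
        (measure_mono hsub).trans (measure_union_le _ _)
    _ ≤ ∑ i ∈ I, (ν (A i) + δ) + μ (⋃ i ∈ Finset.range N, A i)ᶜ := by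
        gcongr
        refine (measure_biUnion_finset_le _ _).trans (Finset.sum_le_sum fun i hi => hle i ?_)
        exact Finset.mem_range.1 (Finset.mem_filter.1 hi).1
    _ = ν (⋃ i ∈ I, A i) + (I.card * δ + μ (⋃ i ∈ Finset.range N, A i)ᶜ) := by
        rw [Finset.sum_add_distrib, measure_biUnion_finset (fun i _ j _ hij => hdisj hij)
          (fun i _ => hA i), Finset.sum_const, nsmul_eq_mul, add_assoc]
    _ ≤ _ := by
        gcongr
        simpa using Finset.card_filter_le (Finset.range N) _

/-- Convergence of the masses of the members of arbitrarily fine countable partitions implies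
convergence in the Prohorov distance. -/
lemma tendsto_levyProkhorovDist_of_partition {Ω ι : Type*} [MeasurableSpace Ω]
    [PseudoEMetricSpace Ω] {L : Filter ι} {μ : Measure Ω} [IsFiniteMeasure μ] {ν : ι → Measure Ω}
    [∀ l, IsFiniteMeasure (ν l)] (huniv : Tendsto (fun l => ν l univ) L (𝓝 (μ univ)))
    (hpart : ∀ ε : ℝ, 0 < ε → ∃ A : ℕ → Set Ω, (∀ i, MeasurableSet (A i)) ∧
      Pairwise (Function.onFun Disjoint A) ∧ ⋃ i, A i = univ ∧
      (∀ i, ∀ x ∈ A i, ∀ y ∈ A i, edist x y < ENNReal.ofReal ε) ∧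
      ∀ i, Tendsto (fun l => ν l (A i)) L (𝓝 (μ (A i)))) :
    Tendsto (fun l => levyProkhorovDist μ (ν l)) L (𝓝 0) := by
  suffices h : Tendsto (fun l => levyProkhorovEDist μ (ν l)) L (𝓝 0) by
    exact (ENNReal.tendsto_toReal ENNReal.zero_ne_top).comp h
  rw [ENNReal.tendsto_nhds_zero]
  intro e he
  rcases eq_or_ne e ⊤ with rfl | he'
  · simp
  obtain ⟨A, hA, hdisj, hcov, hsmall, hlim⟩ := hpart e.toReal (ENNReal.toReal_pos he.ne' he')
  let R : ℕ → Set Ω := fun N => (⋃ i ∈ Finset.range N, A i)ᶜ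
  have hRm : ∀ N, MeasurableSet (⋃ i ∈ Finset.range N, A i) := fun N =>
    Finset.measurableSet_biUnion _ fun i _ => hA i
  have hR : Tendsto (fun N => μ (R N)) atTop (𝓝 0) := by
    have h0 : ⋂ N, R N = ∅ := by
      rw [← compl_iUnion, compl_empty_iff]
      refine eq_univ_of_forall fun x => ?_
      obtain ⟨i, hi⟩ := mem_iUnion.1 (hcov ▸ mem_univ x : x ∈ ⋃ i, A i)
      exact mem_iUnion.2 ⟨i + 1, mem_iUnion₂.2 ⟨i, by simp, hi⟩⟩
    rw [← measure_empty (μ := μ), ← h0]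
    refine tendsto_measure_iInter_atTop (fun N => (hRm N).compl.nullMeasurableSet) ?_
      ⟨0, measure_ne_top _ _⟩
    intro N M hNM
    exact compl_subset_compl.2
      (biUnion_subset_biUnion_left (by simpa using hNM))
  have he2 : 0 < e / 2 := ENNReal.half_pos he.ne'
  obtain ⟨N, hN⟩ := (hR.eventually_lt_const he2).exists
  obtain ⟨δ, hδ, hδN⟩ : ∃ δ : ℝ≥0∞, 0 < δ ∧ N * δ ≤ e / 2 := by
    refine ⟨e / 2 / (N + 1), ENNReal.div_pos he2.ne' (by simp), ?_⟩
    calc (N : ℝ≥0∞) * (e / 2 / (N + 1)) ≤ (N + 1) * (e / 2 / (N + 1)) := by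
          gcongr; exact le_self_add
      _ ≤ e / 2 := ENNReal.mul_div_le
  -- The remainder is the total mass minus finitely many cells, so `huniv` prevents mass from
  -- escaping into the tail of the partition.
  have hRν : Tendsto (fun l => ν l (R N)) L (𝓝 (μ (R N))) := by
    have h : ∀ κ : Measure Ω, IsFiniteMeasure κ →
        κ (R N) = κ univ - ∑ i ∈ Finset.range N, κ (A i) := fun κ _ => by
      simp only [R]
      rw [measure_compl (hRm N) (measure_ne_top _ _),
        measure_biUnion_finset (fun i _ j _ hij => hdisj hij) (fun i _ => hA i)]
    rw [h μ inferInstance]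
    simp only [fun l => h (ν l) inferInstance]
    exact ENNReal.Tendsto.sub huniv (tendsto_finsetSum _ fun i _ => hlim i)
      (Or.inl (measure_ne_top _ _))
  have hev : ∀ᶠ l in L, ∀ i ∈ Finset.range N,
      μ (A i) ≤ ν l (A i) + δ ∧ ν l (A i) ≤ μ (A i) + δ := by
    rw [Filter.eventually_all_finset]
    intro i _
    filter_upwards [(ENNReal.tendsto_nhds (measure_ne_top μ (A i))).1 (hlim i) δ hδ] with l hl
    exact ⟨tsub_le_iff_right.1 hl.1, hl.2⟩
  filter_upwards [hev, hRν.eventually_lt_const hN] with l hl hlR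
  refine sInf_le fun B _ => ⟨?_, ?_⟩
  · refine (measure_le_thickening_add_of_partition hA hdisj hsmall
      (fun i hi => (hl i (Finset.mem_range.2 hi)).1) B).trans ?_
    gcongr
    exact (add_le_add hδN hN.le).trans_eq (ENNReal.add_halves e)
  · refine (measure_le_thickening_add_of_partition hA hdisj hsmall
      (fun i hi => (hl i (Finset.mem_range.2 hi)).2) B).trans ?_
    gcongr
    exact (add_le_add hδN hlR.le).trans_eq (ENNReal.add_halves e)

lemma exists_partition_small (X : Type*) [PseudoEMetricSpace X]
    [TopologicalSpace.SeparableSpace X] [MeasurableSpace X] [OpensMeasurableSpace X] {ε : ℝ≥0∞}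
    (hε : 0 < ε) :
    ∃ A : ℕ → Set X, (∀ i, MeasurableSet (A i)) ∧ Pairwise (Function.onFun Disjoint A) ∧
      ⋃ i, A i = univ ∧ ∀ i, ∀ x ∈ A i, ∀ y ∈ A i, edist x y < ε := by
  rcases isEmpty_or_nonempty X with hX | hX
  · exact ⟨fun _ => ∅, fun _ => .empty, fun _ _ _ => disjoint_bot_left,
      Subsingleton.elim _ _, fun _ x => hX.elim x⟩
  let u := TopologicalSpace.denseSeq X
  let V : ℕ → Set X := fun i => eball (u i) (ε / 2)
  refine ⟨disjointed V, fun i => MeasurableSet.disjointed (fun j => isOpen_eball.measurableSet) i,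
    disjoint_disjointed V, ?_, fun i x hx y hy => ?_⟩
  · rw [iUnion_disjointed]
    refine eq_univ_of_forall fun x => ?_
    obtain ⟨i, hi⟩ := (TopologicalSpace.denseRange_denseSeq X).exists_mem_open
      (isOpen_eball (x := x) (ε := ε / 2)) ⟨x, mem_eball_self (ENNReal.half_pos hε.ne')⟩
    exact mem_iUnion.2 ⟨i, mem_eball_comm.1 hi⟩
  · have hx' : edist x (u i) < ε / 2 := disjointed_subset V i hx
    have hy' : edist y (u i) < ε / 2 := disjointed_subset V i hy
    calc edist x y ≤ edist x (u i) + edist y (u i) := edist_triangle_right _ _ _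
      _ < ε / 2 + ε / 2 := ENNReal.add_lt_add hx' hy'
      _ = ε := ENNReal.add_halves ε

end ProkhorovConvergence

/-! ### Countably many evaluations determine the Borel σ-algebra -/

section Borel

variable {S : Type*} [MetricSpace S] [MeasurableSpace S] [BorelSpace S] {C : Set S}

lemma tendsto_prokhorov_of_partition {L : Filter (Space C)} {μ : Space C} {r : ℝ} (hr : 0 < r)
    {A : ℕ → ℕ → Set ↥(Cᶜ)} (hA : ∀ j i, MeasurableSet (A j i))
    (hdisj : ∀ j, Pairwise (Function.onFun Disjoint (A j))) (hcov : ∀ j, ⋃ i, A j i = univ)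
    (hsmall : ∀ j i, ∀ x ∈ A j i, ∀ y ∈ A j i, edist x y < ENNReal.ofReal (1 / (j + 1 : ℝ)))
    (h : Tendsto (fun ν => eval C (away C r) ν) L (𝓝 (eval C (away C r) μ)))
    (hlim : ∀ j i, Tendsto (fun ν => eval C (A j i ∩ away C r) ν) L
      (𝓝 (eval C (A j i ∩ away C r) μ))) :
    Tendsto (fun ν => levyProkhorovDist (restr μ r) (restr ν r)) L (𝓝 0) := by
  have hfin : ∀ ν : Space C, IsFiniteMeasure (restr ν r) := fun ν => isFiniteMeasure_restr ν hr
  have hpre : ∀ (ν : Space C) (B : Set ↥(Cᶜ)),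
      restr ν r (Subtype.val ⁻¹' B) = eval C (B ∩ away C r) ν := fun ν B => by
    rw [restr_apply, Subtype.image_preimage_coe, inter_comm, eval]
  refine tendsto_levyProkhorovDist_of_partition ?_ fun ε hε => ?_
  · have huniv : ∀ ν : Space C, restr ν r univ = eval C (away C r) ν := fun ν => by
      simpa only [preimage_univ, univ_inter] using hpre ν univ
    simpa only [huniv] using h
  · obtain ⟨j, hj⟩ := exists_nat_one_div_lt hε
    refine ⟨fun i => Subtype.val ⁻¹' A j i, fun i => measurable_subtype_coe (hA j i),
      fun i k hik => (hdisj j hik).preimage _, ?_, fun i x hx y hy => ?_, fun i => ?_⟩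
    · rw [← preimage_iUnion, hcov, preimage_univ]
    · exact (hsmall j i x hx y hy).trans_le (ENNReal.ofReal_le_ofReal hj.le)
    · simpa only [hpre] using hlim j i

/-- If the masses of `away C q` and the Prohorov distances `p_q` converge for all rational `q > 0`,
then `p_r` converges for all `r` with `μ {x | d(x, C) = r} = 0`. -/
lemma tendsto_prokhorov_of_continuousAt {L : Filter (Space C)} {μ : Space C} {r : ℝ} (hr : 0 < r)
    (hcont : ContinuousAt (fun s => μ.1.real (away C s)) r)
    (h : ∀ q : ℚ, 0 < q → Tendsto (fun ν => eval C (away C q) ν) L (𝓝 (eval C (away C q) μ)))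
    (hP : ∀ q : ℚ, 0 < q →
      Tendsto (fun ν => levyProkhorovDist (restr μ q) (restr ν q)) L (𝓝 0)) :
    Tendsto (fun ν => levyProkhorovDist (restr μ r) (restr ν r)) L (𝓝 0) := by
  have hreal : ∀ q : ℚ, 0 < q →
      Tendsto (fun ν : Space C => ν.1.real (away C q)) L (𝓝 (μ.1.real (away C q))) := fun q hq =>
    (ENNReal.tendsto_toReal (measure_ne_top_of_boundedAway μ
      (boundedAway_away (by exact_mod_cast hq)))).comp (h q hq)
  refine tendsto_order.2 ⟨fun c hc => Eventually.of_forall fun ν => hc.trans_le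
    (prokhorov_nonneg _ _), fun c hc => ?_⟩
  -- Rationals `a < r < b` are chosen so that the masses for `μ`, and eventually for `ν`, drop by
  -- less than `c / 4` from `a` to `b`. With `p_a < c / 4` this gives `p_r < 3c / 4`. The radius `b`
  -- bounds `ν (away C r)` from below.
  obtain ⟨η, hη, hηr⟩ := Metric.continuousAt_iff.1 hcont (c / 8) (by linarith)
  obtain ⟨a, ha, har⟩ := exists_rat_btwn (max_lt hr (by linarith : r - η < r))
  obtain ⟨b, hrb, hb⟩ := exists_rat_btwn (by linarith : r < r + η)
  rw [max_lt_iff] at ha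
  have ha0 : 0 < a := by exact_mod_cast ha.1
  have hb0 : 0 < b := by exact_mod_cast hr.trans hrb
  have h1 := hηr (x := a) (by rw [Real.dist_eq, abs_lt]; constructor <;> linarith)
  have h2 := hηr (x := b) (by rw [Real.dist_eq, abs_lt]; constructor <;> linarith)
  rw [Real.dist_eq, abs_lt] at h1 h2
  have h3 : μ.1.real (away C a) - μ.1.real (away C b) < c / 4 := by linarith
  have hmono : ∀ (ν : Space C), ν.1.real (away C b) ≤ ν.1.real (away C r) := fun ν =>
    antitoneOn_measureReal_away ν hr (hr.trans hrb) hrb.le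
  filter_upwards [((hreal a ha0).sub (hreal b hb0)).eventually_lt_const h3,
    (hP a ha0).eventually_lt_const (by linarith : 0 < c / 4)] with ν hν1 hν2
  have h4 := (abs_sub_le_iff.1 (abs_prokhorov_sub_le μ ν ha.1 har.le)).2
  linarith [hmono μ, hmono ν]

/-- Dominated convergence with majorant `exp (-r)`. It requires a countably generated filter, which
the pullback of neighbourhoods in a countable product is. -/
lemma tendsto_distance {L : Filter (Space C)} [L.IsCountablyGenerated] {μ : Space C}
    (h : ∀ᵐ r ∂volume.restrict (Ioi (0 : ℝ)),
      Tendsto (fun ν => levyProkhorovDist (restr μ r) (restr ν r)) L (𝓝 0)) :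
    Tendsto (fun ν => distance μ ν) L (𝓝 0) := by
  have := tendsto_integral_filter_of_dominated_convergence (l := L)
    (F := fun ν r => Real.exp (-r) * (levyProkhorovDist (restr μ r) (restr ν r) /
      (1 + levyProkhorovDist (restr μ r) (restr ν r)))) (f := fun _ => 0)
    (fun r => Real.exp (-r))
    (Eventually.of_forall fun ν => aestronglyMeasurable_distance_integrand μ ν)
    (Eventually.of_forall fun ν => ae_of_all _ (norm_distance_integrand_le μ ν))
    integrableOn_exp_neg ?_
  · simpa [distance] using! this
  · filter_upwards [h] with r hr
    simpa using (hr.div (hr.const_add 1) (by simp)).const_mul (Real.exp (-r))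

/-- The Borel σ-algebra is contained in every σ-algebra for which all evaluations are measurable. -/
lemma borelAlgebra_le [TopologicalSpace.SeparableSpace S] {m : MeasurableSpace (Space C)}
    (hm : ∀ A : Set ↥(Cᶜ), MeasurableSet A → Measurable (eval C A)) :
    borelAlgebra C ≤ m := by
  have : SecondCountableTopology S := UniformSpace.secondCountable_of_separable S
  choose A hA hdisj hcov hsmall using fun j : ℕ => exists_partition_small ↥(Cᶜ)
    (ε := ENNReal.ofReal (1 / (j + 1 : ℝ))) (by rw [ENNReal.ofReal_pos]; positivity)
  -- The index `none` records the whole of `away C q`, and `some (j, i)` its trace on cell `i` of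
  -- the `j`-th partition.
  let E : Option (ℕ × ℕ) × {q : ℚ // 0 < q} → Set ↥(Cᶜ) := fun k =>
    (k.1.elim univ fun p => A p.1 p.2) ∩ away C (k.2 : ℚ)
  have hE : ∀ k, MeasurableSet (E k) := by
    rintro ⟨_ | p, q⟩
    · exact MeasurableSet.univ.inter (measurableSet_away C _)
    · exact (hA _ _).inter (measurableSet_away C _)
  let Φ : Space C → Option (ℕ × ℕ) × {q : ℚ // 0 < q} → ℝ≥0∞ := fun μ k => eval C (E k) μ
  have hΦ : Measurable Φ := measurable_pi_lambda _ fun k => hm _ (hE k)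
  have key : ∀ μ : Space C, Tendsto (fun ν => distance μ ν) (comap Φ (𝓝 (Φ μ))) (𝓝 0) := by
    intro μ
    have hlim : ∀ k, Tendsto (fun ν => eval C (E k) ν) (comap Φ (𝓝 (Φ μ)))
        (𝓝 (eval C (E k) μ)) := fun k =>
      ((continuous_apply k).tendsto (Φ μ)).comp tendsto_comap
    have haway : ∀ q : ℚ, 0 < q → Tendsto (fun ν => eval C (away C q) ν) (comap Φ (𝓝 (Φ μ)))
        (𝓝 (eval C (away C q) μ)) := fun q hq => by
      simpa [E] using hlim (none, ⟨q, hq⟩)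
    have hP : ∀ q : ℚ, 0 < q → Tendsto (fun ν => levyProkhorovDist (restr μ q) (restr ν q))
        (comap Φ (𝓝 (Φ μ))) (𝓝 0) := fun q hq =>
      tendsto_prokhorov_of_partition (by exact_mod_cast hq) hA hdisj hcov hsmall (haway q hq)
        fun j i => hlim (some (j, i), ⟨q, hq⟩)
    refine tendsto_distance ?_
    filter_upwards [ae_continuousAt_measureReal_away μ, ae_restrict_mem measurableSet_Ioi]
      with r hr hr0
    exact tendsto_prokhorov_of_continuousAt hr0 hr haway hP
  refine MeasurableSpace.generateFrom_le fun U hU => ?_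
  let b := TopologicalSpace.countableBasis (Option (ℕ × ℕ) × {q : ℚ // 0 < q} → ℝ≥0∞)
  have hb := TopologicalSpace.isBasis_countableBasis
    (Option (ℕ × ℕ) × {q : ℚ // 0 < q} → ℝ≥0∞)
  -- By `key`, each point of `U` has a basic `V` around its image with `Φ ⁻¹' V ⊆ U`. Only countably
  -- many `V` occur.
  have hUeq : U = ⋃ V ∈ {V ∈ b | Φ ⁻¹' V ⊆ U}, Φ ⁻¹' V := by
    refine Subset.antisymm (fun μ hμ => ?_) (iUnion₂_subset fun V hV => hV.2)
    obtain ⟨ε, hε, hεU⟩ := hU μ hμ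
    obtain ⟨t, ht, htε⟩ := (key μ).eventually_lt_const hε
    obtain ⟨V, hVb, hμV, hVt⟩ := hb.mem_nhds_iff.1 ht
    exact mem_iUnion₂.2 ⟨V, ⟨hVb, (preimage_mono hVt).trans (htε.trans hεU)⟩, hμV⟩
  rw [hUeq]
  refine MeasurableSet.biUnion ((TopologicalSpace.countable_countableBasis _).mono fun V hV => hV.1)
    fun V hV => ?_
  exact hΦ (hb.isOpen hV.1).measurableSet

end Borel

end MO

/-! ### The three descriptions of the Borel σ-algebra -/

theorem proposition2p2 {S : Type*} [MetricSpace S] [CompleteSpace S]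
    [TopologicalSpace.SeparableSpace S] [MeasurableSpace S] [BorelSpace S]
    (C : Set S) (hC : IsClosed C) :
    MO.borelAlgebra C = MO.neighbourhoodAlgebra C ∧
    (∀ D : Set (Set ↥(Cᶜ)), (∀ A ∈ D, MeasurableSet A) → IsPiSystem D →
      MeasurableSpace.generateFrom {A ∈ D | MO.BoundedAway C A} =
        (inferInstance : MeasurableSpace ↥(Cᶜ)) →
      ⋃₀ {A ∈ D | MO.BoundedAway C A} = Set.univ →
      IsLeast {m : MeasurableSpace (MO.Space C) | ∀ A ∈ D, Measurable[m] (MO.eval C A)}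
        (MO.borelAlgebra C)) ∧
    IsLeast {m : MeasurableSpace (MO.Space C) |
        ∀ A : Set ↥(Cᶜ), MeasurableSet A → MO.BoundedAway C A → Measurable[m] (MO.eval C A)}
      (MO.borelAlgebra C) := by
  refine ⟨le_antisymm ?_ ?_, fun D hD hpi hgen hcov => ⟨fun A hA => ?_, fun m hm => ?_⟩,
    fun A hA _ => ?_, fun m hm => ?_⟩
  · exact MO.borelAlgebra_le fun A hA => MO.measurable_eval_neighbourhoodAlgebra hC hA
  · exact MO.neighbourhoodAlgebra_le fun A hA => MO.measurable_eval_borelAlgebra hC hA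
  · exact MO.measurable_eval_borelAlgebra hC (hD A hA)
  · refine MO.borelAlgebra_le fun A hA => MO.measurable_eval_of_isPiSystem
      (fun E hE F hF hne => ?_) (fun E hE => hE.2) hgen hcov (fun E hE => hm E hE.1) hA
    exact ⟨hpi E hE.1 F hF.1 hne, hE.2.mono inter_subset_left⟩
  · exact MO.measurable_eval_borelAlgebra hC hA
  · exact MO.borelAlgebra_le fun A hA => MO.measurable_eval_of_isClosed hC
      (fun F hF hFb => hm F hF.measurableSet hFb) hA
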